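/- Let $n,d\ge 1$. For $(Q,\mu)$ with generators $g_1,\dots,g_n\in\mathbb R^d$ (the columns of $Q$, so that $Qx=\sum_j x_jg_j$) and $\mu\in\mathbb R^d$, let $Z(Q,\mu)=\{Qx+\mu : x\in[0,1]^n\}$. Let $\mathcal Z_n(\mathbb R^d)$ be the space of all $(Q,\mu)$ modulo permutations of the generators, with the quotient topology. Let $P\subset\mathbb R^d$ be a (nonempty) polytope, and let $d_P(Z)=d(P,Z)$ be the Euclidean Hausdorff distance and $d_P^c(Z)=d(\mathrm{Vert}(P),\mathrm{Vert}(Z))$ the coarse Hausdorff distance, as functions on $\mathcal Z_n(\mathbb R^d)$. The generators are in general position if any at most $d$ of them are linearly independent. A point $x$ is Hausdorff stable relative to a polytope $X$ if $x$ is an interior point of $X$, or if $x-\Pi(x,X)$ lies in the relative interior of the normal cone of $X$ at the nearest point $\Pi(x,X)$. Fix $Z=Z(Q,\mu)$ with generators in general position. For a set $S$ of pairs $(p,q)\in P\times Z$ put $$\mathcal C_S=\{(\Delta Q,\Delta\mu) : \langle \Delta Q\,e+\Delta\mu,\;p-q\rangle\ge 0\ \text{ for all } (p,q)\in S \text{ and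 } e\in[0,1]^n \text{ with } Qe+\mu=q\}.$$ (For the sets $S$ below, whenever their pairs are at positive distance, the point $e$ is unique for each $q$.) (1) Assume that every vertex of $P$ is Hausdorff stable relative to $Z$ and every vertex of $Z$ is Hausdorff stable relative to $P$. Let $\mathcal C(P,Z)=\mathcal C_S$, where $S$ is the set of pairs achieving $d_P(Z)$: the pairs $(p,q)\in P\times Z$ with $\|p-q\|=d_P(Z)$ such that $p$ is a vertex of $P$ and $q=\Pi(p,Z)$, or $q$ is a vertex of $Z$ and $p=\Pi(q,P)$. If $q$ is a vertex of $Z$ for every such pair, then $\mathcal C(P,Z)$ has empty interior if and only if $Z$ is a local minimum of $d_P$. (2) Assume $P\ne Z$. Let $\mathcal C^c(P,Z)=\mathcal C_S$, where $S$ is the set of pairs of vertices achieving $d_P^c(Z)$: the pairs $(p,q)\in\mathrm{Vert}(P)\times\mathrm{Vert}(Z)$ with $\|p-q\|=d_P^c(Z)$ such that $q$ is a vertex of $Z$ nearest to $p$ or $p$ is a vertex of $P$ nearest to $q$. If $Z$ is a local minimum of $d_P^c$, then $\mathcal C^c(P,Z)$ has empty interior. If moreover every vertex of $P$ or of $Z$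 whose distance to the vertex set of the other polytope equals $d_P^c(Z)$ has only one nearest vertex there, then $\mathcal C^c(P,Z)$ has empty interior if and only if $Z$ is a local minimum of $d_P^c$. -/

import Mathlib

/-- A polytope in `ℝ^d`: the convex hull of a nonempty finite set of points. -/
def IsPolytope {d : ℕ} (P : Set (EuclideanSpace ℝ (Fin d))) : Prop :=
  ∃ s : Finset (EuclideanSpace ℝ (Fin d)), s.Nonempty ∧ P = convexHull ℝ (s : Set _)

/-- The vertices of a polytope, i.e. its extreme points. -/
abbrev polytopeVertices {d : ℕ} (P : Set (EuclideanSpace ℝ (Fin d))) :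
    Set (EuclideanSpace ℝ (Fin d)) :=
  P.extremePoints ℝ

/-- Parameters `(Q, μ)`: the generators `Q j` (the matrix `Q`, stored generator by generator)
and the translation vector `μ`. -/
abbrev ZonotopeParam (n d : ℕ) : Type :=
  (Fin n → EuclideanSpace ℝ (Fin d)) × EuclideanSpace ℝ (Fin d)

/-- The affine map `x ↦ Q x + μ` from `ℝ^n` to `ℝ^d`. -/
noncomputable def zonotopeMap {n d : ℕ} (a : ZonotopeParam n d) (x : Fin n → ℝ) :
    EuclideanSpace ℝ (Fin d) :=
  ∑ j, x j • a.1 j + a.2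

/-- The zonotope `Z(Q, μ)`: the image of the unit cube `[0,1]^n` under `x ↦ Q x + μ`. -/
noncomputable def zonotope {n d : ℕ} (a : ZonotopeParam n d) : Set (EuclideanSpace ℝ (Fin d)) :=
  zonotopeMap a '' Set.Icc 0 1

/-- `Lift(q)`: the points of the unit cube that are mapped to `q`. -/
def zonotopeLift {n d : ℕ} (a : ZonotopeParam n d) (q : EuclideanSpace ℝ (Fin d)) :
    Set (Fin n → ℝ) :=
  {e | e ∈ Set.Icc 0 1 ∧ zonotopeMap a e = q}

/-- Permuting the generators. -/
def zonotopeSetoid (n d : ℕ) : Setoid (ZonotopeParam n d) where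
  r a b := ∃ σ : Equiv.Perm (Fin n), (∀ j, b.1 j = a.1 (σ j)) ∧ b.2 = a.2
  iseqv :=
    { refl := fun _ => ⟨1, fun _ => rfl, rfl⟩
      symm := by
        rintro a b ⟨σ, h1, h2⟩
        exact ⟨σ.symm, fun j => by rw [h1, Equiv.apply_symm_apply], h2.symm⟩
      trans := by
        rintro a b c ⟨σ, h1, h2⟩ ⟨τ, h3, h4⟩
        exact ⟨τ.trans σ, fun j => by rw [h3, h1]; rfl, h4.trans h2⟩ }

theorem zonotope_subset_of_perm {n d : ℕ} {a b : ZonotopeParam n d} (σ : Equiv.Perm (Fin n))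
    (h1 : ∀ j, b.1 j = a.1 (σ j)) (h2 : b.2 = a.2) : zonotope b ⊆ zonotope a := by
  rintro _ ⟨x, hx, rfl⟩
  refine ⟨fun j => x (σ.symm j), ⟨fun j => hx.1 (σ.symm j), fun j => hx.2 (σ.symm j)⟩, ?_⟩
  unfold zonotopeMap
  rw [h2, ← Equiv.sum_comp σ (fun j => x (σ.symm j) • a.1 j)]
  simp [h1]

theorem zonotope_eq_of_rel {n d : ℕ} (a b : ZonotopeParam n d)
    (h : (zonotopeSetoid n d).r a b) : zonotope a = zonotope b := by
  obtain ⟨τ, h3, h4⟩ := (zonotopeSetoid n d).symm h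
  obtain ⟨σ, h1, h2⟩ := h
  exact Set.Subset.antisymm (zonotope_subset_of_perm τ h3 h4) (zonotope_subset_of_perm σ h1 h2)

/-- The space of zonotopes in `ℝ^d` with `n` generators: the parameter space modulo permutations
of the generators, with the quotient topology. -/
abbrev ZonotopeSpace (n d : ℕ) : Type := Quotient (zonotopeSetoid n d)

/-- The class of `(Q, μ)` in the space of zonotopes. -/
def ZonotopeSpace.mk {n d : ℕ} (a : ZonotopeParam n d) : ZonotopeSpace n d :=
  Quotient.mk (zonotopeSetoid n d) a

/-- The underlying subset of `ℝ^d`. -/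
noncomputable def ZonotopeSpace.toSet {n d : ℕ} (Z : ZonotopeSpace n d) :
    Set (EuclideanSpace ℝ (Fin d)) :=
  Quotient.lift zonotope zonotope_eq_of_rel Z

/-- The function `d_P`: the Hausdorff distance to `P`, on the space of zonotopes. -/
noncomputable def hausdorffTo {n d : ℕ} (P : Set (EuclideanSpace ℝ (Fin d)))
    (Z : ZonotopeSpace n d) : ℝ :=
  Metric.hausdorffDist P Z.toSet

/-- The coarse Hausdorff distance `d^c`: the Hausdorff distance between the vertex sets. -/
noncomputable def coarseHausdorffDist {d : ℕ} (P Z : Set (EuclideanSpace ℝ (Fin d))) : ℝ :=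
  Metric.hausdorffDist (polytopeVertices P) (polytopeVertices Z)

/-- The function `d_P^c` on the space of zonotopes. -/
noncomputable def coarseHausdorffTo {n d : ℕ} (P : Set (EuclideanSpace ℝ (Fin d)))
    (Z : ZonotopeSpace n d) : ℝ :=
  coarseHausdorffDist P Z.toSet

/-- The generators are in general position: any at most `d` of them are linearly independent. -/
def GeneratorsInGeneralPosition {n d : ℕ} (Q : Fin n → EuclideanSpace ℝ (Fin d)) : Prop :=
  ∀ s : Finset (Fin n), s.card ≤ d → LinearIndependent ℝ (fun j : s => Q j)

/-- `q` is a point of `S` nearest to `x`. -/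
def IsNearestPoint {d : ℕ} (S : Set (EuclideanSpace ℝ (Fin d)))
    (x q : EuclideanSpace ℝ (Fin d)) : Prop :=
  q ∈ S ∧ dist x q = Metric.infDist x S

/-- The (outer) normal cone of `P` at `q`, with apex translated to the origin. -/
def normalConeAt {d : ℕ} (P : Set (EuclideanSpace ℝ (Fin d))) (q : EuclideanSpace ℝ (Fin d)) :
    Set (EuclideanSpace ℝ (Fin d)) :=
  {v | ∀ y ∈ P, inner ℝ v (y - q) ≤ 0}

/-- `x` is Hausdorff stable relative to `P`: it is an interior point of `P`, or it lies in the
relative interior of the normal cone attached to `P` at the projection of `x` to `P`. -/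
def HausdorffStable {d : ℕ} (P : Set (EuclideanSpace ℝ (Fin d)))
    (x : EuclideanSpace ℝ (Fin d)) : Prop :=
  x ∈ interior P ∨ ∃ q, IsNearestPoint P x q ∧ x - q ∈ intrinsicInterior ℝ (normalConeAt P q)

/-- The locality conditions on `P` and `Z(Q, μ)`. -/
def LocalityConditions {n d : ℕ} (P : Set (EuclideanSpace ℝ (Fin d))) (a : ZonotopeParam n d) :
    Prop :=
  GeneratorsInGeneralPosition a.1 ∧
    (∀ p ∈ polytopeVertices P, HausdorffStable (zonotope a) p) ∧
    (∀ q ∈ polytopeVertices (zonotope a), HausdorffStable P q)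

/-- The pairs `(p, q) ∈ P × Z` achieving the Hausdorff distance: `‖p - q‖ = d(P, Z)`, one of the
two points is a vertex of its polytope, and the other one is its projection. -/
def achievingPairs {d : ℕ} (P Z : Set (EuclideanSpace ℝ (Fin d))) :
    Set (EuclideanSpace ℝ (Fin d) × EuclideanSpace ℝ (Fin d)) :=
  {x | dist x.1 x.2 = Metric.hausdorffDist P Z ∧
    ((x.1 ∈ polytopeVertices P ∧ IsNearestPoint Z x.1 x.2) ∨
      (x.2 ∈ polytopeVertices Z ∧ IsNearestPoint P x.2 x.1))}

/-- The pairs of vertices achieving the coarse Hausdorff distance: `‖p - q‖ = d^c(P, Z)`, and one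
of the two is a vertex nearest to the other. -/
def coarseAchievingPairs {d : ℕ} (P Z : Set (EuclideanSpace ℝ (Fin d))) :
    Set (EuclideanSpace ℝ (Fin d) × EuclideanSpace ℝ (Fin d)) :=
  {x | x.1 ∈ polytopeVertices P ∧ x.2 ∈ polytopeVertices Z ∧
    dist x.1 x.2 = coarseHausdorffDist P Z ∧
    (IsNearestPoint (polytopeVertices Z) x.1 x.2 ∨ IsNearestPoint (polytopeVertices P) x.2 x.1)}

/-- The cone of all `(ΔQ, Δμ)` with `⟪ΔQ e + Δμ, p - q⟫ ≥ 0` for every pair `(p, q)` in `S` and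
`e = Lift(q)`. For generators in general position and pairs at positive distance, the lift of such
a `q` is unique, so that quantifying over all lifts is the same as taking the lift. -/
def coneOfPairs {n d : ℕ} (S : Set (EuclideanSpace ℝ (Fin d) × EuclideanSpace ℝ (Fin d)))
    (a : ZonotopeParam n d) : Set (ZonotopeParam n d) :=
  {δ | ∀ x ∈ S, ∀ e ∈ zonotopeLift a x.2, 0 ≤ inner ℝ (zonotopeMap δ e) (x.1 - x.2)}

/-- The feasibility cone `C(P, Z)` of `Z = Z(Q, μ)` relative to `P`. -/
def feasibilityCone {n d : ℕ} (P : Set (EuclideanSpace ℝ (Fin d))) (a : ZonotopeParam n d) :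
    Set (ZonotopeParam n d) :=
  coneOfPairs (achievingPairs P (zonotope a)) a

/-- The feasibility cone formed with the pairs achieving the coarse Hausdorff distance. -/
def coarseFeasibilityCone {n d : ℕ} (P : Set (EuclideanSpace ℝ (Fin d)))
    (a : ZonotopeParam n d) : Set (ZonotopeParam n d) :=
  coneOfPairs (coarseAchievingPairs P (zonotope a)) a

/-- Every vertex of `P` or `Z` at which the coarse Hausdorff distance is attained has only one
nearest vertex in the other polytope. -/
def CoarseStable {d : ℕ} (P Z : Set (EuclideanSpace ℝ (Fin d))) : Prop :=
  (∀ p ∈ polytopeVertices P,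
      Metric.infDist p (polytopeVertices Z) = coarseHausdorffDist P Z →
        ∃! q, IsNearestPoint (polytopeVertices Z) p q) ∧
    (∀ q ∈ polytopeVertices Z,
      Metric.infDist q (polytopeVertices P) = coarseHausdorffDist P Z →
        ∃! p, IsNearestPoint (polytopeVertices P) q p)

/-! A cube vertex `e` has signs `2 * e j - 1 = ±1`. It is exposed when some `u` has inner products
with the generators of exactly these signs. Then `u` attains its maximum over the cube only at `e`,
so `e` maps to a vertex with a unique lift. When no generator vanishes, every vertex of the zonotope
arises this way. In general position the set of exposed cube vertices is locally constant
(`GeneratorsInGeneralPosition.eventually_exposedCubeVertices_eq`), so near `a` the vertices of the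
zonotope are fixed affine functions of the parameter. The quotient map by permutations is open, so
local minimality can be tested on parameters.

Local minimum implies empty interior: a direction in the interior of the cone satisfies all its
inequalities strictly, because each `p - q` is nonzero. Moving along it shortens every achieving
pair to first order, and the remaining distances stay below the old maximum by continuity. Since
finitely many vertices control both Hausdorff distances, the distance drops.

Empty interior implies local minimum: finitely many strict inequalities define an open set, so no
displacement satisfies them all, and each nearby `b` has a pair `(p, q)` along which `q` does not
move towards `p`. That pair alone keeps the distance from dropping. For `d_P` a supporting half
space bounds the distance from below: stability makes `p - q` support the perturbed zonotope at the
moved vertex, or else the half space supporting `P` at `p` serves. For the coarse distance,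
uniqueness of the nearest vertex keeps all competitors farther away. -/

open Filter Topology

/-- The vertices of the unit cube `[0,1]^n`. -/
def cubeVertices (n : ℕ) : Set (Fin n → ℝ) :=
  Set.univ.pi fun _ => {0, 1}

/-- The vertices of the cube that are the unique maximizers over the cube of a linear functional
pulled back along `x ↦ Q x + μ`. -/
def exposedCubeVertices {n d : ℕ} (a : ZonotopeParam n d) : Set (Fin n → ℝ) :=
  {e | e ∈ cubeVertices n ∧
    ∃ u : EuclideanSpace ℝ (Fin d), ∀ j, 0 < (2 * e j - 1) * inner ℝ u (a.1 j)}

/-! ### Zonotopes as images of the cube, and their vertices -/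

section ZonotopeMap

variable {n d : ℕ}

theorem cubeVertices_eq_or {e : Fin n → ℝ} (he : e ∈ cubeVertices n) (j : Fin n) :
    e j = 0 ∨ e j = 1 := by
  simpa using he j (Set.mem_univ j)

theorem finite_cubeVertices (n : ℕ) : (cubeVertices n).Finite :=
  Set.Finite.pi fun _ => Set.toFinite _

theorem cubeVertices_subset_Icc (n : ℕ) : cubeVertices n ⊆ Set.Icc 0 1 := by
  intro e he
  constructor <;> intro j <;> rcases cubeVertices_eq_or he j with h | h <;> simp [h]

theorem convexHull_cubeVertices (n : ℕ) :
    convexHull ℝ (cubeVertices n) = Set.Icc (0 : Fin n → ℝ) 1 := by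
  rw [cubeVertices, convexHull_pi]
  ext x
  simp [convexHull_pair, segment_eq_Icc, Pi.le_def]

theorem exposedCubeVertices_subset (a : ZonotopeParam n d) :
    exposedCubeVertices a ⊆ cubeVertices n := fun _ h => h.1

theorem finite_exposedCubeVertices (a : ZonotopeParam n d) : (exposedCubeVertices a).Finite :=
  (finite_cubeVertices n).subset (exposedCubeVertices_subset a)

theorem zonotopeMap_add_left (a b : ZonotopeParam n d) (x : Fin n → ℝ) :
    zonotopeMap (a + b) x = zonotopeMap a x + zonotopeMap b x := by
  simp only [zonotopeMap, Prod.fst_add, Prod.snd_add, Pi.add_apply, smul_add,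
    Finset.sum_add_distrib]
  abel

theorem zonotopeMap_smul_left (t : ℝ) (a : ZonotopeParam n d) (x : Fin n → ℝ) :
    zonotopeMap (t • a) x = t • zonotopeMap a x := by
  simp only [zonotopeMap, Prod.smul_fst, Prod.smul_snd, Pi.smul_apply, smul_add, Finset.smul_sum]
  congr 1
  exact Finset.sum_congr rfl fun j _ => smul_comm _ _ _

theorem zonotopeMap_sub_left (a b : ZonotopeParam n d) (x : Fin n → ℝ) :
    zonotopeMap (a - b) x = zonotopeMap a x - zonotopeMap b x := by
  rw [eq_sub_iff_add_eq, ← zonotopeMap_add_left, sub_add_cancel]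

theorem continuous_zonotopeMap_left (x : Fin n → ℝ) :
    Continuous fun a : ZonotopeParam n d => zonotopeMap a x := by
  unfold zonotopeMap
  fun_prop

theorem continuous_zonotopeMap (a : ZonotopeParam n d) : Continuous (zonotopeMap a) := by
  unfold zonotopeMap
  fun_prop

theorem inner_zonotopeMap_sub (a : ZonotopeParam n d) (u : EuclideanSpace ℝ (Fin d))
    (x y : Fin n → ℝ) :
    inner ℝ u (zonotopeMap a x - zonotopeMap a y) = ∑ j, (x j - y j) * inner ℝ u (a.1 j) := by
  have : zonotopeMap a x - zonotopeMap a y = ∑ j, (x j - y j) • a.1 j := by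
    simp [zonotopeMap, sub_smul]
  rw [this, inner_sum]
  simp [inner_smul_right]

theorem zonotope_eq_convexHull (a : ZonotopeParam n d) :
    zonotope a = convexHull ℝ (zonotopeMap a '' cubeVertices n) := by
  let f : (Fin n → ℝ) →ᵃ[ℝ] EuclideanSpace ℝ (Fin d) :=
    (Fintype.linearCombination ℝ a.1).toAffineMap + AffineMap.const ℝ _ a.2
  have hf : zonotopeMap a = f := by
    ext1 x
    simp [f, zonotopeMap, Fintype.linearCombination_apply]
  rw [zonotope, ← convexHull_cubeVertices, hf, AffineMap.image_convexHull]

theorem convex_zonotope (a : ZonotopeParam n d) : Convex ℝ (zonotope a) := by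
  rw [zonotope_eq_convexHull]
  exact convex_convexHull ℝ _

theorem zonotope_nonempty (a : ZonotopeParam n d) : (zonotope a).Nonempty :=
  (Set.nonempty_Icc.2 zero_le_one).image _

theorem isPolytope_zonotope (a : ZonotopeParam n d) : IsPolytope (zonotope a) := by
  have hfin := (finite_cubeVertices n).image (zonotopeMap a)
  refine ⟨hfin.toFinset, ?_, by rw [hfin.coe_toFinset, zonotope_eq_convexHull]⟩
  have := zonotope_nonempty a
  rw [zonotope_eq_convexHull, convexHull_nonempty_iff] at this
  exact hfin.toFinset_nonempty.2 this

theorem zonotopeMap_mem_zonotope (a : ZonotopeParam n d) {e : Fin n → ℝ}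
    (he : e ∈ cubeVertices n) : zonotopeMap a e ∈ zonotope a :=
  Set.mem_image_of_mem _ (cubeVertices_subset_Icc n he)

/-- For `x j` in `[0,1]`, the difference `e j - x j` is zero or has the sign of `2 * e j - 1`. -/
theorem sub_mul_nonneg_of_mem_cubeVertices {e x : Fin n → ℝ} (he : e ∈ cubeVertices n)
    (hx : x ∈ Set.Icc 0 1) {j : Fin n} {r : ℝ} (h : 0 ≤ (2 * e j - 1) * r) :
    0 ≤ (e j - x j) * r := by
  have h0 : 0 ≤ x j := hx.1 j
  have h1 : x j ≤ 1 := hx.2 j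
  rcases cubeVertices_eq_or he j with hj | hj <;> rw [hj] at h ⊢ <;> nlinarith

theorem inner_sub_zonotopeMap_nonneg {a : ZonotopeParam n d} {u : EuclideanSpace ℝ (Fin d)}
    {e : Fin n → ℝ} (he : e ∈ cubeVertices n)
    (hu : ∀ j, 0 ≤ (2 * e j - 1) * inner ℝ u (a.1 j))
    {z : EuclideanSpace ℝ (Fin d)} (hz : z ∈ zonotope a) :
    0 ≤ inner ℝ u (zonotopeMap a e - z) := by
  obtain ⟨x, hx, rfl⟩ := hz
  rw [inner_zonotopeMap_sub]
  exact Finset.sum_nonneg fun j _ => sub_mul_nonneg_of_mem_cubeVertices he hx (hu j)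

theorem eq_of_inner_sub_zonotopeMap_eq_zero {a : ZonotopeParam n d}
    {u : EuclideanSpace ℝ (Fin d)} {e : Fin n → ℝ} (he : e ∈ cubeVertices n)
    (hu : ∀ j, 0 < (2 * e j - 1) * inner ℝ u (a.1 j)) {x : Fin n → ℝ} (hx : x ∈ Set.Icc 0 1)
    (h : inner ℝ u (zonotopeMap a e - zonotopeMap a x) = 0) : x = e := by
  rw [inner_zonotopeMap_sub, Finset.sum_eq_zero_iff_of_nonneg fun j _ =>
    sub_mul_nonneg_of_mem_cubeVertices he hx (hu j).le] at h
  ext j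
  have hne : inner ℝ u (a.1 j) ≠ (0 : ℝ) := right_ne_zero_of_mul (hu j).ne'
  have := (mul_eq_zero.1 (h j (Finset.mem_univ j))).resolve_right hne
  linarith

/-- This is the uniqueness of the lift over a vertex: a functional exposing `e` takes the same value
at `x`, hence is also maximal there. -/
theorem eq_of_zonotopeMap_eq {a : ZonotopeParam n d} {e x : Fin n → ℝ}
    (he : e ∈ exposedCubeVertices a) (hx : x ∈ Set.Icc 0 1)
    (h : zonotopeMap a x = zonotopeMap a e) : x = e := by
  obtain ⟨he, u, hu⟩ := he
  exact eq_of_inner_sub_zonotopeMap_eq_zero he hu hx (by rw [h, sub_self, inner_zero_right])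

theorem zonotopeMap_mem_polytopeVertices {a : ZonotopeParam n d} {e : Fin n → ℝ}
    (he : e ∈ exposedCubeVertices a) : zonotopeMap a e ∈ polytopeVertices (zonotope a) := by
  have he' := he
  obtain ⟨hc, u, hu⟩ := he'
  refine (mem_extremePoints.2 ⟨zonotopeMap_mem_zonotope a hc, ?_⟩)
  intro y hy z hz hyz
  have key : ∀ y ∈ zonotope a, inner ℝ u (zonotopeMap a e - y) = (0 : ℝ) →
      y = zonotopeMap a e := by
    rintro _ ⟨x, hx, rfl⟩ h
    rw [eq_of_inner_sub_zonotopeMap_eq_zero hc hu hx h]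
  have hy0 := inner_sub_zonotopeMap_nonneg hc (fun j => (hu j).le) hy
  have hz0 := inner_sub_zonotopeMap_nonneg hc (fun j => (hu j).le) hz
  obtain ⟨s, t, hs, ht, hst, h⟩ := hyz
  have hsum : s * inner ℝ u (zonotopeMap a e - y) + t * inner ℝ u (zonotopeMap a e - z)
      = (0 : ℝ) := by
    rw [← inner_smul_right, ← inner_smul_right, ← inner_add_right, smul_sub, smul_sub,
      sub_add_sub_comm, ← add_smul, hst, h, one_smul, sub_self, inner_zero_right]
  have h1 := mul_nonneg hs.le hy0
  have h2 := mul_nonneg ht.le hz0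
  exact ⟨key y hy ((mul_eq_zero.1 (by linarith)).resolve_left hs.ne'),
    key z hz ((mul_eq_zero.1 (by linarith)).resolve_left ht.ne')⟩

/-- An extreme point can be strictly separated from the hull of the other images of cube vertices.
Flipping coordinate `j` of `e` moves the image by `±` a nonzero generator, so the separating
functional strictly drops, which is the sign condition at `j`. -/
theorem exists_exposedCubeVertices_of_mem_polytopeVertices {a : ZonotopeParam n d}
    (ha : ∀ j, a.1 j ≠ 0) {q : EuclideanSpace ℝ (Fin d)}
    (hq : q ∈ polytopeVertices (zonotope a)) :
    ∃ e ∈ exposedCubeVertices a, zonotopeMap a e = q := by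
  have hq' := hq
  rw [polytopeVertices, zonotope_eq_convexHull] at hq'
  obtain ⟨e, he, rfl⟩ := extremePoints_convexHull_subset hq'
  refine ⟨e, ⟨he, ?_⟩, rfl⟩
  set W := zonotopeMap a '' cubeVertices n \ {zonotopeMap a e} with hW
  have hnot : zonotopeMap a e ∉ convexHull ℝ W := by
    intro hmem
    refine (((convex_zonotope a).mem_extremePoints_iff_mem_sdiff_convexHull_sdiff).1 hq).2
      (convexHull_mono ?_ hmem)
    rintro _ ⟨⟨c, hc, rfl⟩, hne⟩
    exact ⟨zonotopeMap_mem_zonotope a hc, hne⟩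
  have hWfin : W.Finite := ((finite_cubeVertices n).image _).subset Set.sdiff_subset
  obtain ⟨f, r, hf, hr⟩ := geometric_hahn_banach_closed_point (convex_convexHull ℝ W)
    (hWfin.isCompact_convexHull ℝ).isClosed hnot
  refine ⟨(InnerProductSpace.toDual ℝ _).symm f, fun j => ?_⟩
  rw [InnerProductSpace.toDual_symm_apply]
  set c := Function.update e j (1 - e j) with hc
  have hcv : c ∈ cubeVertices n := by
    intro i _
    by_cases hij : i = j
    · subst hij
      rcases cubeVertices_eq_or he i with h | h <;> simp [hc, h]
    · simpa [hc, hij] using cubeVertices_eq_or he i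
  have hdiff : zonotopeMap a e - zonotopeMap a c = (2 * e j - 1) • a.1 j := by
    have : zonotopeMap a e - zonotopeMap a c = ∑ i, (e i - c i) • a.1 i := by
      simp [zonotopeMap, sub_smul]
    rw [this, Finset.sum_eq_single j]
    · simp only [hc, Function.update_self]
      congr 1
      ring
    · intro i _ hij
      simp [hc, hij]
    · simp
  have hne : zonotopeMap a c ≠ zonotopeMap a e := by
    intro h
    rw [h, sub_self] at hdiff
    rcases smul_eq_zero.1 hdiff.symm with h | h
    · rcases cubeVertices_eq_or he j with h' | h' <;> rw [h'] at h <;> norm_num at h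
    · exact ha j h
  have hlt := (hf _ (subset_convexHull ℝ W ⟨Set.mem_image_of_mem _ hcv, hne⟩)).trans hr
  have : f (zonotopeMap a e - zonotopeMap a c) = (2 * e j - 1) * f (a.1 j) := by
    rw [hdiff, map_smul, smul_eq_mul]
  rw [← this, map_sub]
  linarith

theorem polytopeVertices_zonotope {a : ZonotopeParam n d} (ha : ∀ j, a.1 j ≠ 0) :
    polytopeVertices (zonotope a) = zonotopeMap a '' exposedCubeVertices a := by
  refine Set.Subset.antisymm
    (fun q hq => exists_exposedCubeVertices_of_mem_polytopeVertices ha hq) ?_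
  rintro _ ⟨e, he, rfl⟩
  exact zonotopeMap_mem_polytopeVertices he

theorem mem_exposedCubeVertices_of_mem_zonotopeLift {a : ZonotopeParam n d}
    (ha : ∀ j, a.1 j ≠ 0) {q : EuclideanSpace ℝ (Fin d)}
    (hq : q ∈ polytopeVertices (zonotope a)) {e : Fin n → ℝ} (he : e ∈ zonotopeLift a q) :
    e ∈ exposedCubeVertices a := by
  obtain ⟨c, hc, rfl⟩ := exists_exposedCubeVertices_of_mem_polytopeVertices ha hq
  rwa [eq_of_zonotopeMap_eq hc he.1 he.2]

end ZonotopeMap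

/-! ### General position and local constancy of the vertex structure -/

section GeneralPosition

variable {n d : ℕ}

theorem GeneratorsInGeneralPosition.ne_zero {Q : Fin n → EuclideanSpace ℝ (Fin d)} (hd : 1 ≤ d)
    (h : GeneratorsInGeneralPosition Q) (j : Fin n) : Q j ≠ 0 :=
  (h {j} (by simpa using hd)).ne_zero ⟨j, by simp⟩

theorem LinearIndependent.exists_inner_eq {ι : Type*} {v : ι → EuclideanSpace ℝ (Fin d)}
    (hv : LinearIndependent ℝ v) (c : ι → ℝ) :
    ∃ w : EuclideanSpace ℝ (Fin d), ∀ i, inner ℝ w (v i) = c i := by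
  obtain ⟨g, hg⟩ := LinearMap.exists_extend ((Module.Basis.span hv).constr ℝ c)
  refine ⟨(InnerProductSpace.toDual ℝ _).symm (LinearMap.toContinuousLinearMap g), fun i => ?_⟩
  rw [InnerProductSpace.toDual_symm_apply, LinearMap.coe_toContinuousLinearMap']
  have := LinearMap.congr_fun hg (Module.Basis.span hv i)
  rwa [Module.Basis.constr_basis, LinearMap.comp_apply, Submodule.subtype_apply,
    Module.Basis.span_apply] at this

/-- Any `d` generators span the space, so if all were orthogonal to `u`, then `u` would be
orthogonal to itself. -/
theorem GeneratorsInGeneralPosition.card_orthogonal_lt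
    {Q : Fin n → EuclideanSpace ℝ (Fin d)} (h : GeneratorsInGeneralPosition Q)
    {u : EuclideanSpace ℝ (Fin d)} (hu : u ≠ 0) :
    (Finset.univ.filter fun j => inner ℝ u (Q j) = (0 : ℝ)).card < d := by
  by_contra! hcard
  obtain ⟨s, hs, hsd⟩ := Finset.exists_subset_card_eq hcard
  have hspan := (h s hsd.le).span_eq_top_of_card_eq_finrank' (by simp [hsd])
  refine hu (inner_self_eq_zero (𝕜 := ℝ).1 ?_)
  have hle : Submodule.span ℝ (Set.range fun j : s => Q j) ≤
      LinearMap.ker (innerSL ℝ u).toLinearMap := by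
    rw [Submodule.span_le]
    rintro _ ⟨j, rfl⟩
    simpa using hs j.2
  have := hle (hspan ▸ Submodule.mem_top : u ∈ _)
  simpa using this

/-- Weak sign conditions can be made strict. The generators orthogonal to `u` are fewer than `d`,
hence independent, so some `w` has the prescribed signs on them; a small step from `u` along `w`
keeps the other signs. -/
theorem GeneratorsInGeneralPosition.mem_exposedCubeVertices {a : ZonotopeParam n d}
    (h : GeneratorsInGeneralPosition a.1) {e : Fin n → ℝ} (he : e ∈ cubeVertices n)
    {u : EuclideanSpace ℝ (Fin d)} (hu : u ≠ 0)
    (hpos : ∀ j, 0 ≤ (2 * e j - 1) * inner ℝ u (a.1 j)) : e ∈ exposedCubeVertices a := by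
  obtain ⟨w, hw⟩ := (h _ (h.card_orthogonal_lt hu).le).exists_inner_eq
    fun j => 2 * e (j : Fin n) - 1
  have hev : ∀ j, ∀ᶠ t : ℝ in 𝓝[>] 0, 0 < (2 * e j - 1) * inner ℝ (u + t • w) (a.1 j) := by
    intro j
    have hne : 2 * e j - 1 ≠ 0 := by
      rcases cubeVertices_eq_or he j with h' | h' <;> rw [h'] <;> norm_num
    by_cases hj : inner ℝ u (a.1 j) = (0 : ℝ)
    · filter_upwards [self_mem_nhdsWithin] with t ht
      have := hw ⟨j, by simpa using hj⟩
      simp only at this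
      rw [inner_add_left, hj, real_inner_smul_left, this, zero_add]
      -- On a generator orthogonal to `u` the product equals `t * (2 * e j - 1) ^ 2`.
      have h2 := mul_pos (Set.mem_Ioi.1 ht) (pow_pos (abs_pos.2 hne) 2)
      rw [sq_abs] at h2
      linarith
    · refine nhdsWithin_le_nhds ?_
      have hc : Continuous fun t : ℝ => (2 * e j - 1) * inner ℝ (u + t • w) (a.1 j) := by
        fun_prop
      refine hc.continuousAt.eventually (lt_mem_nhds ?_)
      simpa using (hpos j).lt_of_ne' (mul_ne_zero hne hj)
  obtain ⟨t, ht⟩ := (eventually_all.2 hev).exists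
  exact ⟨he, u + t • w, ht⟩

/-- Being exposed is an open condition. So is not being exposed: at `a` every unit vector violates
some sign condition strictly, and compactness of the sphere makes this uniform near `a`. -/
theorem GeneratorsInGeneralPosition.eventually_exposedCubeVertices_eq {a : ZonotopeParam n d}
    (hn : 1 ≤ n) (h : GeneratorsInGeneralPosition a.1) :
    ∀ᶠ b in 𝓝 a, exposedCubeVertices b = exposedCubeVertices a := by
  have key : ∀ e ∈ cubeVertices n, ∀ᶠ b in 𝓝 a,
      (e ∈ exposedCubeVertices b ↔ e ∈ exposedCubeVertices a) := by
    intro e he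
    by_cases hea : e ∈ exposedCubeVertices a
    · obtain ⟨_, u, hu⟩ := hea
      have : ∀ᶠ b : ZonotopeParam n d in 𝓝 a, ∀ j, 0 < (2 * e j - 1) * inner ℝ u (b.1 j) := by
        refine eventually_all.2 fun j => ?_
        have hc : Continuous fun b : ZonotopeParam n d => (2 * e j - 1) * inner ℝ u (b.1 j) := by
          fun_prop
        exact hc.continuousAt.eventually (lt_mem_nhds (hu j))
      filter_upwards [this] with b hb
      exact ⟨fun _ => ⟨he, u, hu⟩, fun _ => ⟨he, u, hb⟩⟩
    · have : ∀ᶠ b : ZonotopeParam n d in 𝓝 a,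
          ∀ u ∈ Metric.sphere (0 : EuclideanSpace ℝ (Fin d)) 1,
            ∃ j, (2 * e j - 1) * inner ℝ u (b.1 j) < 0 := by
        refine (isCompact_sphere _ _).eventually_forall_of_forall_eventually fun u hu => ?_
        have hu0 : u ≠ 0 := ne_zero_of_mem_unit_sphere ⟨u, hu⟩
        have : ∃ j, (2 * e j - 1) * inner ℝ u (a.1 j) < 0 := by
          by_contra! hcon
          exact hea (h.mem_exposedCubeVertices he hu0 hcon)
        obtain ⟨j, hj⟩ := this
        have hc : Continuous fun z : ZonotopeParam n d × EuclideanSpace ℝ (Fin d) =>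
            (2 * e j - 1) * inner ℝ z.2 (z.1.1 j) := by
          fun_prop
        filter_upwards [hc.continuousAt.eventually (gt_mem_nhds hj)] with z hz
        exact ⟨j, hz⟩
      filter_upwards [this] with b hb
      refine iff_of_false ?_ hea
      rintro ⟨_, u, hu⟩
      -- The strict inequality at generator `0`, which exists as `1 ≤ n`, excludes `u = 0`;
      -- rescaling then puts `u` on the sphere.
      have hu0 : u ≠ 0 := by
        rintro rfl
        simpa using hu ⟨0, hn⟩
      obtain ⟨j, hj⟩ := hb (‖u‖⁻¹ • u) (by simp [norm_smul, hu0])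
      rw [real_inner_smul_left] at hj
      have := mul_pos (inv_pos.2 (norm_pos_iff.2 hu0)) (hu j)
      linarith
  filter_upwards [((finite_cubeVertices n).eventually_all).2 key] with b hb
  ext e
  exact ⟨fun he => (hb e he.1).1 he, fun he => (hb e he.1).2 he⟩

theorem GeneratorsInGeneralPosition.eventually_polytopeVertices_eq {a : ZonotopeParam n d}
    (hn : 1 ≤ n) (hd : 1 ≤ d) (h : GeneratorsInGeneralPosition a.1) :
    ∀ᶠ b in 𝓝 a,
      polytopeVertices (zonotope b) = zonotopeMap b '' exposedCubeVertices a := by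
  have h0 : ∀ᶠ b : ZonotopeParam n d in 𝓝 a, ∀ j, b.1 j ≠ 0 := by
    refine eventually_all.2 fun j => ?_
    have hc : Continuous fun b : ZonotopeParam n d => b.1 j := by fun_prop
    exact hc.continuousAt.eventually_ne (h.ne_zero hd j)
  filter_upwards [h0, h.eventually_exposedCubeVertices_eq hn] with b hb hE
  rw [polytopeVertices_zonotope hb, hE]

end GeneralPosition

/-! ### Passing to the quotient by permutations -/

section Quotient

variable {n d : ℕ}

theorem ZonotopeSpace.continuous_mk : Continuous (ZonotopeSpace.mk (n := n) (d := d)) :=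
  continuous_quotient_mk'

/-- The saturation of an open set is the union of its preimages under the permutation maps, which
are continuous. -/
theorem ZonotopeSpace.isOpenMap_mk : IsOpenMap (ZonotopeSpace.mk (n := n) (d := d)) := by
  intro U hU
  have hq : IsQuotientMap (ZonotopeSpace.mk (n := n) (d := d)) := isQuotientMap_quotient_mk'
  rw [← hq.isOpen_preimage]
  have : ZonotopeSpace.mk ⁻¹' (ZonotopeSpace.mk '' U) =
      ⋃ σ : Equiv.Perm (Fin n), (fun b : ZonotopeParam n d => (fun j => b.1 (σ j), b.2)) ⁻¹' U := by
    ext b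
    simp only [Set.mem_preimage, Set.mem_image, Set.mem_iUnion]
    constructor
    · rintro ⟨c, hc, h⟩
      obtain ⟨σ, h1, h2⟩ := Quotient.exact h.symm
      refine ⟨σ, ?_⟩
      have : c = (fun j => b.1 (σ j), b.2) := Prod.ext (funext h1) h2
      rwa [this] at hc
    · rintro ⟨σ, hσ⟩
      have hrel : (zonotopeSetoid n d).r b (fun j => b.1 (σ j), b.2) := ⟨σ, fun _ => rfl, rfl⟩
      exact ⟨_, hσ, (Quotient.sound hrel).symm⟩
  rw [this]
  exact isOpen_iUnion fun σ => hU.preimage (by fun_prop)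

theorem ZonotopeSpace.isLocalMin_mk_iff {F : ZonotopeSpace n d → ℝ} {a : ZonotopeParam n d} :
    IsLocalMin F (ZonotopeSpace.mk a) ↔ IsLocalMin (fun b => F (ZonotopeSpace.mk b)) a := by
  rw [IsLocalMin, IsLocalMin, IsMinFilter, IsMinFilter,
    ← ZonotopeSpace.isOpenMap_mk.map_nhds_eq ZonotopeSpace.continuous_mk.continuousAt,
    eventually_map]

end Quotient

/-! ### Basic facts on polytopes -/

section Polytope

variable {d : ℕ} {P : Set (EuclideanSpace ℝ (Fin d))}

theorem IsPolytope.isCompact (hP : IsPolytope P) : IsCompact P := by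
  obtain ⟨s, _, rfl⟩ := hP
  exact s.finite_toSet.isCompact_convexHull ℝ

theorem IsPolytope.convex (hP : IsPolytope P) : Convex ℝ P := by
  obtain ⟨s, _, rfl⟩ := hP
  exact convex_convexHull ℝ _

theorem IsPolytope.nonempty (hP : IsPolytope P) : P.Nonempty := by
  obtain ⟨s, hs, rfl⟩ := hP
  exact hs.to_set.convexHull

theorem IsPolytope.finite_polytopeVertices (hP : IsPolytope P) :
    (polytopeVertices P).Finite := by
  obtain ⟨s, _, rfl⟩ := hP
  exact s.finite_toSet.subset extremePoints_convexHull_subset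

theorem IsPolytope.polytopeVertices_nonempty (hP : IsPolytope P) :
    (polytopeVertices P).Nonempty :=
  hP.isCompact.extremePoints_nonempty hP.nonempty

theorem IsPolytope.convexHull_polytopeVertices (hP : IsPolytope P) :
    convexHull ℝ (polytopeVertices P) = P := by
  rw [← (hP.finite_polytopeVertices.isCompact_convexHull ℝ).isClosed.closure_eq]
  exact closure_convexHull_extremePoints hP.isCompact hP.convex

end Polytope

/-! ### Hausdorff distances controlled by finitely many points -/

section HausdorffDist

theorem hausdorffEDist_ne_top_of_isCompact {X : Type*} [PseudoMetricSpace X] {A B : Set X}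
    (hA : IsCompact A) (hB : IsCompact B) (hA' : A.Nonempty) (hB' : B.Nonempty) :
    Metric.hausdorffEDist A B ≠ ⊤ :=
  Metric.hausdorffEDist_ne_top_of_nonempty_of_bounded hA' hB' hA.isBounded hB.isBounded

/-- Bounds on a Hausdorff distance pass through non-strict inequalities; finiteness leaves room for
a uniform bound still strictly below `D`. -/
theorem Set.Finite.exists_bound_lt {X : Type*} {A : Set X} (hA : A.Finite) {f : X → ℝ} {D : ℝ}
    (hD : 0 < D) (h : ∀ x ∈ A, f x < D) : ∃ r, 0 ≤ r ∧ r < D ∧ ∀ x ∈ A, f x ≤ r := by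
  have : ∀ᶠ r in 𝓝[<] D, ∀ x ∈ A, f x ≤ r := hA.eventually_all.2 fun x hx =>
    nhdsWithin_le_nhds ((lt_mem_nhds (h x hx)).mono fun _ => le_of_lt)
  have hlt : ∀ᶠ r in 𝓝[<] D, r < D := self_mem_nhdsWithin
  have hpos : ∀ᶠ r in 𝓝[<] D, 0 < r := nhdsWithin_le_nhds (lt_mem_nhds hD)
  obtain ⟨r, h1, h2, h3⟩ := (this.and (hlt.and hpos)).exists
  exact ⟨r, le_of_lt h3, h2, h1⟩

theorem hausdorffDist_lt_of_finite {X : Type*} [PseudoMetricSpace X] {A B : Set X} {D : ℝ}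
    (hA : A.Finite) (hB : B.Finite) (hD : 0 < D) (h1 : ∀ p ∈ A, Metric.infDist p B < D)
    (h2 : ∀ q ∈ B, Metric.infDist q A < D) : Metric.hausdorffDist A B < D := by
  obtain ⟨r, hr0, hrD, hr⟩ := hA.exists_bound_lt hD h1
  obtain ⟨s, hs0, hsD, hs⟩ := hB.exists_bound_lt hD h2
  exact (Metric.hausdorffDist_le_of_infDist (le_max_of_le_left hr0)
    (fun x hx => le_max_of_le_left (hr x hx)) fun x hx => le_max_of_le_right (hs x hx)).trans_lt
      (max_lt hrD hsD)

/-- The closed `r`-thickening of a convex set is convex, so it contains the hull of any set it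
contains. -/
theorem infDist_le_of_mem_convexHull {E : Type*} [NormedAddCommGroup E] [NormedSpace ℝ E]
    {A B : Set E} (hB : Convex ℝ B) (hB' : B.Nonempty) {r : ℝ} (hr : 0 ≤ r)
    (h : ∀ x ∈ A, Metric.infDist x B ≤ r) {x : E} (hx : x ∈ convexHull ℝ A) :
    Metric.infDist x B ≤ r := by
  have hmem : ∀ y, y ∈ Metric.cthickening r B ↔ Metric.infDist y B ≤ r := fun y => by
    rw [Metric.mem_cthickening_iff,
      ENNReal.le_ofReal_iff_toReal_le (Metric.infEDist_ne_top hB') hr, Metric.infDist]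
  exact (hmem x).1 (convexHull_min (fun y hy => (hmem y).2 (h y hy)) (hB.cthickening r) hx)

theorem IsPolytope.hausdorffDist_lt {d : ℕ} {P Z : Set (EuclideanSpace ℝ (Fin d))}
    (hP : IsPolytope P) (hZ : IsPolytope Z) {D : ℝ} (hD : 0 < D)
    (h1 : ∀ p ∈ polytopeVertices P, Metric.infDist p Z < D)
    (h2 : ∀ q ∈ polytopeVertices Z, Metric.infDist q P < D) : Metric.hausdorffDist P Z < D := by
  obtain ⟨r, hr0, hrD, hr⟩ := hP.finite_polytopeVertices.exists_bound_lt hD h1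
  obtain ⟨s, hs0, hsD, hs⟩ := hZ.finite_polytopeVertices.exists_bound_lt hD h2
  refine (Metric.hausdorffDist_le_of_infDist (le_max_of_le_left hr0)
    (fun x hx => le_max_of_le_left ?_) fun x hx => le_max_of_le_right ?_).trans_lt
      (max_lt hrD hsD)
  · rw [← hP.convexHull_polytopeVertices] at hx
    exact infDist_le_of_mem_convexHull hZ.convex hZ.nonempty hr0 hr hx
  · rw [← hZ.convexHull_polytopeVertices] at hx
    exact infDist_le_of_mem_convexHull hP.convex hP.nonempty hs0 hs hx

end HausdorffDist

/-! ### Nearest points, half spaces and relative interiors -/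

section Projection

variable {d : ℕ} {K : Set (EuclideanSpace ℝ (Fin d))}

theorem IsCompact.exists_isNearestPoint (hK : IsCompact K) (hne : K.Nonempty)
    (x : EuclideanSpace ℝ (Fin d)) : ∃ q, IsNearestPoint K x q := by
  obtain ⟨q, hq, h⟩ := hK.exists_infDist_eq_dist hne x
  exact ⟨q, hq, h.symm⟩

theorem IsNearestPoint.sub_mem_normalConeAt (hK : Convex ℝ K) {x q : EuclideanSpace ℝ (Fin d)}
    (h : IsNearestPoint K x q) : x - q ∈ normalConeAt K q := by
  refine (norm_eq_iInf_iff_real_inner_le_zero hK h.1).1 ?_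
  have := h.2
  rw [Metric.infDist_eq_iInf] at this
  simpa only [dist_eq_norm] using this

theorem IsNearestPoint.unique (hK : Convex ℝ K) {x q r : EuclideanSpace ℝ (Fin d)}
    (hq : IsNearestPoint K x q) (hr : IsNearestPoint K x r) : q = r := by
  have h1 := hq.sub_mem_normalConeAt hK r hr.1
  have h2 := hr.sub_mem_normalConeAt hK q hq.1
  have h3 : inner ℝ (r - q) (r - q) ≤ (0 : ℝ) := by
    have : inner ℝ (r - q) (r - q) = inner ℝ (x - q) (r - q) + inner ℝ (x - r) (q - r) := by
      rw [← neg_sub r q, inner_neg_right, ← sub_eq_add_neg, ← inner_sub_left]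
      congr 1
      abel
    linarith
  exact (sub_eq_zero.1 (inner_self_eq_zero (𝕜 := ℝ).1 (h3.antisymm real_inner_self_nonneg))).symm

/-- The distance of `x` to a set lying in a half space is at least the distance to the half
space. -/
theorem norm_le_infDist_of_inner_le {u x : EuclideanSpace ℝ (Fin d)} (hne : K.Nonempty)
    (h : ∀ y ∈ K, ‖u‖ ^ 2 ≤ inner ℝ u (x - y)) : ‖u‖ ≤ Metric.infDist x K := by
  refine (Metric.le_infDist hne).2 fun y hy => ?_
  rcases (norm_nonneg u).eq_or_lt with hu | hu
  · rw [← hu]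
    exact dist_nonneg
  · rw [dist_eq_norm]
    have := (h y hy).trans (real_inner_le_norm _ _)
    rw [sq] at this
    exact le_of_mul_le_mul_left this hu

/-- The direction `v - w` is parallel to the affine span of `N`, in which `N` is a neighbourhood of
`u`. -/
theorem exists_sub_smul_mem_of_mem_intrinsicInterior {N : Set (EuclideanSpace ℝ (Fin d))}
    {u v w : EuclideanSpace ℝ (Fin d)} (hu : u ∈ intrinsicInterior ℝ N) (hv : v ∈ N)
    (hw : w ∈ N) : ∃ s : ℝ, 0 < s ∧ u + s • (v - w) ∈ N := by
  obtain ⟨y, hy, rfl⟩ := mem_intrinsicInterior.1 hu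
  have hdir : v - w ∈ (affineSpan ℝ N).direction :=
    AffineSubspace.vsub_mem_direction (subset_affineSpan ℝ N hv) (subset_affineSpan ℝ N hw)
  have hmem : ∀ s : ℝ, (y : EuclideanSpace ℝ (Fin d)) + s • (v - w) ∈ affineSpan ℝ N := fun s => by
    have := AffineSubspace.vadd_mem_of_mem_direction
      ((affineSpan ℝ N).direction.smul_mem s hdir) y.2
    rwa [vadd_eq_add, add_comm] at this
  let f : ℝ → affineSpan ℝ N := fun s => ⟨y + s • (v - w), hmem s⟩
  have hf : Continuous f := by
    refine Continuous.subtype_mk ?_ _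
    fun_prop
  have h0 : f 0 = y := Subtype.ext (by simp [f])
  have hev : ∀ᶠ s in 𝓝 (0 : ℝ), f s ∈ interior (Subtype.val ⁻¹' N) :=
    hf.continuousAt.eventually (by rw [h0]; exact isOpen_interior.mem_nhds hy)
  obtain ⟨s, hs, hs0⟩ := ((hev.filter_mono nhdsWithin_le_nhds).and
    (self_mem_nhdsWithin : Set.Ioi (0 : ℝ) ∈ 𝓝[>] 0)).exists
  exact ⟨s, hs0, (interior_subset hs : f s ∈ _)⟩

end Projection

/-! ### Normal cones of zonotopes at vertices -/

section Stability

variable {n d : ℕ}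

/-- The relative interior of the normal cone of a zonotope at a vertex consists of the vectors
that are maximized exactly at this vertex. -/
theorem pos_of_mem_intrinsicInterior_normalConeAt {a : ZonotopeParam n d} {e : Fin n → ℝ}
    (he : e ∈ exposedCubeVertices a) {u : EuclideanSpace ℝ (Fin d)}
    (hu : u ∈ intrinsicInterior ℝ (normalConeAt (zonotope a) (zonotopeMap a e))) (j : Fin n) :
    0 < (2 * e j - 1) * inner ℝ u (a.1 j) := by
  obtain ⟨hc, u₀, hu₀⟩ := he
  have h0 : u₀ ∈ normalConeAt (zonotope a) (zonotopeMap a e) := fun y hy => by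
    have := inner_sub_zonotopeMap_nonneg hc (fun j => (hu₀ j).le) hy
    rw [← neg_sub, inner_neg_right]
    linarith
  have h1 : (0 : EuclideanSpace ℝ (Fin d)) ∈ normalConeAt (zonotope a) (zonotopeMap a e) :=
    fun y _ => by rw [inner_zero_left]
  -- Both `0` and the exposing vector `u₀` are normal, so `u - s • u₀` is normal too. Testing it on
  -- the neighbour `c` of `e` gives `u` at least `s` times the strict sign condition of `u₀`.
  obtain ⟨s, hs, hmem⟩ := exists_sub_smul_mem_of_mem_intrinsicInterior hu h1 h0
  set c := Function.update e j (1 - e j) with hcdef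
  have hcv : c ∈ cubeVertices n := by
    intro i _
    by_cases hij : i = j
    · subst hij
      rcases cubeVertices_eq_or hc i with h | h <;> simp [hcdef, h]
    · simpa [hcdef, hij] using cubeVertices_eq_or hc i
  have h2 := hmem _ (zonotopeMap_mem_zonotope a hcv)
  rw [inner_zonotopeMap_sub, Finset.sum_eq_single j (fun i _ hij => by simp [hcdef, hij])
    (by simp), zero_sub, inner_add_left, real_inner_smul_left, inner_neg_left] at h2
  simp only [hcdef, Function.update_self] at h2
  nlinarith [mul_pos hs (hu₀ j)]

end Stability

/-! ### Cones of pairs and first-order variation of distances -/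

section Cone

variable {n d : ℕ}

/-- Translating slightly by `-t • (p - q)` stays in the cone but lowers the inner product by `t * ‖p
- q‖ ^ 2`. -/
theorem inner_pos_of_mem_interior_coneOfPairs
    {S : Set (EuclideanSpace ℝ (Fin d) × EuclideanSpace ℝ (Fin d))} {a δ : ZonotopeParam n d}
    (hδ : δ ∈ interior (coneOfPairs S a))
    {x : EuclideanSpace ℝ (Fin d) × EuclideanSpace ℝ (Fin d)} (hx : x ∈ S) (hne : x.1 ≠ x.2)
    {e : Fin n → ℝ} (he : e ∈ zonotopeLift a x.2) :
    0 < inner ℝ (zonotopeMap δ e) (x.1 - x.2) := by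
  have hc : Continuous fun t : ℝ => δ - t • ((0, x.1 - x.2) : ZonotopeParam n d) := by fun_prop
  have hev : ∀ᶠ t : ℝ in 𝓝 0, δ - t • ((0, x.1 - x.2) : ZonotopeParam n d) ∈
      interior (coneOfPairs S a) :=
    hc.continuousAt.eventually (isOpen_interior.mem_nhds (by simpa using hδ))
  obtain ⟨t, ht, ht0⟩ := ((hev.filter_mono nhdsWithin_le_nhds).and
    (self_mem_nhdsWithin : Set.Ioi (0 : ℝ) ∈ 𝓝[>] 0)).exists
  have h := interior_subset ht x hx e he
  have hz : zonotopeMap ((0, x.1 - x.2) : ZonotopeParam n d) e = x.1 - x.2 := by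
    simp [zonotopeMap]
  rw [zonotopeMap_sub_left, zonotopeMap_smul_left, hz, inner_sub_left, real_inner_smul_left] at h
  have hpos : (0 : ℝ) < inner ℝ (x.1 - x.2) (x.1 - x.2) :=
    real_inner_self_pos.2 (sub_ne_zero.2 hne)
  nlinarith [mul_pos (Set.mem_Ioi.1 ht0) hpos]

theorem exists_inner_nonpos_of_interior_coneOfPairs_eq_empty
    {S : Set (EuclideanSpace ℝ (Fin d) × EuclideanSpace ℝ (Fin d))} {a : ZonotopeParam n d}
    (hS : S.Finite) (hlift : ∀ x ∈ S, (zonotopeLift a x.2).Finite)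
    (h : interior (coneOfPairs S a) = ∅) (δ : ZonotopeParam n d) :
    ∃ x ∈ S, ∃ e ∈ zonotopeLift a x.2, inner ℝ (zonotopeMap δ e) (x.1 - x.2) ≤ (0 : ℝ) := by
  by_contra! hcon
  have hev : ∀ᶠ δ' in 𝓝 δ, δ' ∈ coneOfPairs S a := by
    refine hS.eventually_all.2 fun x hx => ((hlift x hx).eventually_all).2 fun e he => ?_
    have hc : Continuous fun δ' : ZonotopeParam n d =>
        inner ℝ (zonotopeMap δ' e) (x.1 - x.2) :=
      (continuous_zonotopeMap_left e).inner continuous_const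
    exact (hc.continuousAt.eventually (lt_mem_nhds (hcon x hx e he))).mono fun _ => le_of_lt
  have : δ ∈ interior (coneOfPairs S a) := mem_interior_iff_mem_nhds.2 hev
  rw [h] at this
  exact this

/-- Shared by both distances: it remains to show, pair by pair, that a vertex not moving towards its
partner prevents `F` from decreasing. -/
theorem isLocalMin_of_interior_coneOfPairs_eq_empty
    {S : Set (EuclideanSpace ℝ (Fin d) × EuclideanSpace ℝ (Fin d))} {a : ZonotopeParam n d}
    (hS : S.Finite) (hlift : ∀ x ∈ S, (zonotopeLift a x.2).Finite)
    (h : interior (coneOfPairs S a) = ∅) {F : ZonotopeParam n d → ℝ}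
    (hF : ∀ x ∈ S, ∀ e ∈ zonotopeLift a x.2, ∀ᶠ b in 𝓝 a,
      inner ℝ (zonotopeMap b e - x.2) (x.1 - x.2) ≤ (0 : ℝ) → F a ≤ F b) :
    IsLocalMin F a := by
  have hev : ∀ᶠ b in 𝓝 a, ∀ x ∈ S, ∀ e ∈ zonotopeLift a x.2,
      inner ℝ (zonotopeMap b e - x.2) (x.1 - x.2) ≤ (0 : ℝ) → F a ≤ F b :=
    hS.eventually_all.2 fun x hx => ((hlift x hx).eventually_all).2 fun e he => hF x hx e he
  filter_upwards [hev] with b hb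
  obtain ⟨x, hx, e, he, hle⟩ :=
    exists_inner_nonpos_of_interior_coneOfPairs_eq_empty hS hlift h (b - a)
  rw [zonotopeMap_sub_left, he.2] at hle
  exact hb x hx e he hle

/-- If the distance is `D`, its square changes by `t * (t * ‖w‖ ^ 2 - 2 * inner ℝ w v)`, negative
for small `t > 0`; below `D`, continuity suffices. -/
theorem eventually_dist_zonotopeMap_lt {a δ : ZonotopeParam n d} {e : Fin n → ℝ} {D : ℝ}
    {p : EuclideanSpace ℝ (Fin d)} (hle : dist p (zonotopeMap a e) ≤ D)
    (hpos : dist p (zonotopeMap a e) = D →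
      0 < inner ℝ (zonotopeMap δ e) (p - zonotopeMap a e)) :
    ∀ᶠ t : ℝ in 𝓝[>] 0, dist p (zonotopeMap (a + t • δ) e) < D := by
  rcases hle.lt_or_eq with hlt | heq
  · have hc : Continuous fun t : ℝ => dist p (zonotopeMap (a + t • δ) e) := by
      refine continuous_const.dist ((continuous_zonotopeMap_left e).comp ?_)
      fun_prop
    exact nhdsWithin_le_nhds (hc.continuousAt.eventually (gt_mem_nhds (by simpa using hlt)))
  · have hpos := hpos heq
    set w := zonotopeMap δ e
    set v := p - zonotopeMap a e with hv
    have hc : Continuous fun t : ℝ => t * ‖w‖ ^ 2 - 2 * inner ℝ w v := by fun_prop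
    have hev : ∀ᶠ t : ℝ in 𝓝[>] 0, t * ‖w‖ ^ 2 - 2 * inner ℝ w v < 0 :=
      nhdsWithin_le_nhds (hc.continuousAt.eventually (gt_mem_nhds (by simpa using hpos)))
    filter_upwards [hev, self_mem_nhdsWithin] with t ht ht0
    rw [← heq, dist_eq_norm, dist_eq_norm, ← hv, zonotopeMap_add_left, zonotopeMap_smul_left,
      ← sub_sub, ← hv]
    refine lt_of_pow_lt_pow_left₀ 2 (norm_nonneg _) ?_
    rw [norm_sub_sq_real, inner_smul_right, norm_smul, mul_pow, Real.norm_eq_abs, sq_abs,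
      real_inner_comm]
    nlinarith [mul_neg_of_pos_of_neg (Set.mem_Ioi.1 ht0) ht]

theorem dist_le_dist_zonotopeMap {b : ZonotopeParam n d} {e : Fin n → ℝ}
    {p q : EuclideanSpace ℝ (Fin d)}
    (h : inner ℝ (zonotopeMap b e - q) (p - q) ≤ (0 : ℝ)) :
    dist p q ≤ dist p (zonotopeMap b e) := by
  rw [dist_eq_norm, dist_eq_norm, ← sub_sub_sub_cancel_right p (zonotopeMap b e) q]
  refine le_of_sq_le_sq ?_ (norm_nonneg _)
  rw [norm_sub_sq_real (p - q), real_inner_comm]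
  nlinarith [sq_nonneg ‖zonotopeMap b e - q‖]

theorem eventually_lt_dist_zonotopeMap {a : ZonotopeParam n d} {e : Fin n → ℝ} {D : ℝ}
    {p : EuclideanSpace ℝ (Fin d)} (h : D < dist p (zonotopeMap a e)) :
    ∀ᶠ b in 𝓝 a, D < dist p (zonotopeMap b e) :=
  (continuous_const.dist (continuous_zonotopeMap_left e)).continuousAt.eventually (lt_mem_nhds h)

end Cone

/-! ### The coarse Hausdorff distance -/

section Coarse

variable {n d : ℕ} {P : Set (EuclideanSpace ℝ (Fin d))} {a : ZonotopeParam n d}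

theorem IsPolytope.infDist_le_coarseHausdorffDist {Z : Set (EuclideanSpace ℝ (Fin d))}
    (hP : IsPolytope P) (hZ : IsPolytope Z) {p : EuclideanSpace ℝ (Fin d)}
    (hp : p ∈ polytopeVertices P) :
    Metric.infDist p (polytopeVertices Z) ≤ coarseHausdorffDist P Z :=
  Metric.infDist_le_hausdorffDist_of_mem hp <| hausdorffEDist_ne_top_of_isCompact
    hP.finite_polytopeVertices.isCompact hZ.finite_polytopeVertices.isCompact
    hP.polytopeVertices_nonempty hZ.polytopeVertices_nonempty

theorem IsPolytope.infDist_le_hausdorffDist {Z : Set (EuclideanSpace ℝ (Fin d))}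
    (hP : IsPolytope P) (hZ : IsPolytope Z) {p : EuclideanSpace ℝ (Fin d)} (hp : p ∈ P) :
    Metric.infDist p Z ≤ Metric.hausdorffDist P Z :=
  Metric.infDist_le_hausdorffDist_of_mem hp <|
    hausdorffEDist_ne_top_of_isCompact hP.isCompact hZ.isCompact hP.nonempty hZ.nonempty

theorem coarseHausdorffDist_comm (P Z : Set (EuclideanSpace ℝ (Fin d))) :
    coarseHausdorffDist P Z = coarseHausdorffDist Z P :=
  Metric.hausdorffDist_comm

theorem IsPolytope.coarseHausdorffDist_pos {Z : Set (EuclideanSpace ℝ (Fin d))}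
    (hP : IsPolytope P) (hZ : IsPolytope Z) (hne : P ≠ Z) : 0 < coarseHausdorffDist P Z := by
  refine Metric.hausdorffDist_nonneg.lt_of_ne' fun h => hne ?_
  rw [hP.finite_polytopeVertices.isClosed.hausdorffDist_zero_iff_eq
    hZ.finite_polytopeVertices.isClosed (hausdorffEDist_ne_top_of_isCompact
    hP.finite_polytopeVertices.isCompact hZ.finite_polytopeVertices.isCompact
    hP.polytopeVertices_nonempty hZ.polytopeVertices_nonempty)] at h
  rw [← hP.convexHull_polytopeVertices, h, hZ.convexHull_polytopeVertices]

theorem tendsto_add_smul_nhdsGT (a δ : ZonotopeParam n d) :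
    Tendsto (fun t : ℝ => a + t • δ) (𝓝[>] 0) (𝓝 a) := by
  have hc : Continuous fun t : ℝ => a + t • δ := by fun_prop
  have := hc.tendsto 0
  rw [zero_smul, add_zero] at this
  exact this.mono_left nhdsWithin_le_nhds

/-- Along an interior direction each vertex of either polytope gets strictly closer than `D` to its
formerly nearest vertex, and the vertices of the moved zonotope are still indexed by the same cube
vertices. -/
theorem interior_coarseFeasibilityCone_eq_empty (hn : 1 ≤ n) (hd : 1 ≤ d) (hP : IsPolytope P)
    (ha : GeneratorsInGeneralPosition a.1) (hne : P ≠ zonotope a)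
    (hmin : IsLocalMin (fun b => coarseHausdorffDist P (zonotope b)) a) :
    interior (coarseFeasibilityCone P a) = ∅ := by
  refine Set.eq_empty_of_forall_notMem fun δ hδ => ?_
  have hD := hP.coarseHausdorffDist_pos (isPolytope_zonotope a) hne
  set D := coarseHausdorffDist P (zonotope a) with hDdef
  have hV := polytopeVertices_zonotope (ha.ne_zero hd)
  have hZfin := (isPolytope_zonotope a).finite_polytopeVertices
  have hpos : ∀ p ∈ polytopeVertices P, ∀ e ∈ exposedCubeVertices a,
      (IsNearestPoint (polytopeVertices (zonotope a)) p (zonotopeMap a e) ∨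
        IsNearestPoint (polytopeVertices P) (zonotopeMap a e) p) →
      dist p (zonotopeMap a e) = D →
      0 < inner ℝ (zonotopeMap δ e) (p - zonotopeMap a e) := by
    intro p hp e he hnear heq
    refine inner_pos_of_mem_interior_coneOfPairs (x := (p, zonotopeMap a e)) hδ
      ⟨hp, zonotopeMap_mem_polytopeVertices he, heq, hnear⟩ ?_
      ⟨cubeVertices_subset_Icc n he.1, rfl⟩
    exact dist_pos.1 (heq ▸ hD)
  have h1 : ∀ᶠ t : ℝ in 𝓝[>] 0, ∀ p ∈ polytopeVertices P, ∃ e ∈ exposedCubeVertices a,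
      dist p (zonotopeMap (a + t • δ) e) < D := by
    refine hP.finite_polytopeVertices.eventually_all.2 fun p hp => ?_
    obtain ⟨q, hq⟩ := hZfin.isCompact.exists_isNearestPoint
      (isPolytope_zonotope a).polytopeVertices_nonempty p
    obtain ⟨e, he, rfl⟩ := hV ▸ hq.1
    refine (eventually_dist_zonotopeMap_lt ?_ (hpos p hp e he (Or.inl hq))).mono
      fun t ht => ⟨e, he, ht⟩
    rw [hq.2]
    exact hP.infDist_le_coarseHausdorffDist (isPolytope_zonotope a) hp
  have h2 : ∀ᶠ t : ℝ in 𝓝[>] 0, ∀ e ∈ exposedCubeVertices a, ∃ p ∈ polytopeVertices P,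
      dist p (zonotopeMap (a + t • δ) e) < D := by
    refine (finite_exposedCubeVertices a).eventually_all.2 fun e he => ?_
    obtain ⟨p, hp⟩ := hP.finite_polytopeVertices.isCompact.exists_isNearestPoint
      hP.polytopeVertices_nonempty (zonotopeMap a e)
    refine (eventually_dist_zonotopeMap_lt ?_ (hpos p hp.1 e he (Or.inr hp))).mono
      fun t ht => ⟨p, hp.1, ht⟩
    rw [dist_comm, hp.2, hDdef, coarseHausdorffDist_comm]
    exact (isPolytope_zonotope a).infDist_le_coarseHausdorffDist hP
      (zonotopeMap_mem_polytopeVertices he)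
  obtain ⟨t, ht1, ht2, ht3, ht4⟩ := (h1.and (h2.and
    (((tendsto_add_smul_nhdsGT a δ).eventually (ha.eventually_polytopeVertices_eq hn hd)).and
      ((tendsto_add_smul_nhdsGT a δ).eventually hmin)))).exists
  refine ht4.not_gt ?_
  change Metric.hausdorffDist _ _ < D
  rw [ht3]
  refine hausdorffDist_lt_of_finite hP.finite_polytopeVertices
    ((finite_exposedCubeVertices a).image _) hD (fun p hp => ?_) ?_
  · obtain ⟨e, he, h⟩ := ht1 p hp
    exact (Metric.infDist_le_dist_of_mem (Set.mem_image_of_mem _ he)).trans_lt h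
  · rintro _ ⟨e, he, rfl⟩
    obtain ⟨p, hp, h⟩ := ht2 e he
    rw [dist_comm] at h
    exact (Metric.infDist_le_dist_of_mem hp).trans_lt h

theorem finite_zonotopeLift (ha : ∀ j, a.1 j ≠ 0) {q : EuclideanSpace ℝ (Fin d)}
    (hq : q ∈ polytopeVertices (zonotope a)) : (zonotopeLift a q).Finite :=
  (finite_exposedCubeVertices a).subset fun _ he =>
    mem_exposedCubeVertices_of_mem_zonotopeLift ha hq he

/-- Uniqueness of the nearest vertex puts all other vertices strictly beyond `D`, which persists
near `a`. The nearest one itself does not approach, by the obtuse angle in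
`dist_le_dist_zonotopeMap`. -/
theorem isLocalMin_coarseHausdorffDist (hn : 1 ≤ n) (hd : 1 ≤ d) (hP : IsPolytope P)
    (ha : GeneratorsInGeneralPosition a.1) (hstable : CoarseStable P (zonotope a))
    (hint : interior (coarseFeasibilityCone P a) = ∅) :
    IsLocalMin (fun b => coarseHausdorffDist P (zonotope b)) a := by
  have ha0 := ha.ne_zero hd
  have hZ := isPolytope_zonotope a
  have hV := polytopeVertices_zonotope ha0
  have hfin : (coarseAchievingPairs P (zonotope a)).Finite :=
    (hP.finite_polytopeVertices.prod hZ.finite_polytopeVertices).subset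
      fun x hx => ⟨hx.1, hx.2.1⟩
  refine isLocalMin_of_interior_coneOfPairs_eq_empty hfin
    (fun x hx => finite_zonotopeLift ha0 hx.2.1) hint ?_
  rintro ⟨p, q⟩ ⟨hp, hq, hdist, hnear⟩ e he
  dsimp only at hp hq hdist hnear he ⊢
  have heE := mem_exposedCubeVertices_of_mem_zonotopeLift ha0 hq he
  obtain rfl := he.2
  rcases hnear with hnear | hnear
  · have huniq := hstable.1 p hp (hnear.2.symm.trans hdist)
    have hev : ∀ᶠ b in 𝓝 a, ∀ c ∈ exposedCubeVertices a, c ≠ e →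
        coarseHausdorffDist P (zonotope a) < dist p (zonotopeMap b c) := by
      refine (finite_exposedCubeVertices a).eventually_all.2 fun c hc => ?_
      by_cases hce : c = e
      · exact Eventually.of_forall fun _ h => (h hce).elim
      have hcV := zonotopeMap_mem_polytopeVertices hc
      refine (eventually_lt_dist_zonotopeMap ?_).mono fun _ h _ => h
      rw [← hdist, hnear.2]
      refine (Metric.infDist_le_dist_of_mem hcV).lt_of_ne' fun h => hce ?_
      exact eq_of_zonotopeMap_eq heE (cubeVertices_subset_Icc n hc.1)
        (huniq.unique ⟨hcV, h⟩ hnear)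
    filter_upwards [hev, ha.eventually_polytopeVertices_eq hn hd] with b hb hbV hle
    refine le_trans ?_ (hP.infDist_le_coarseHausdorffDist (isPolytope_zonotope b) hp)
    refine (Metric.le_infDist (isPolytope_zonotope b).polytopeVertices_nonempty).2 ?_
    rw [hbV]
    rintro _ ⟨c, hc, rfl⟩
    by_cases hce : c = e
    · rw [hce, ← hdist]
      exact dist_le_dist_zonotopeMap hle
    · exact (hb c hc hce).le
  · have huniq := hstable.2 _ hq (by rw [← hnear.2, dist_comm, hdist])
    have hev : ∀ᶠ b in 𝓝 a, ∀ r ∈ polytopeVertices P, r ≠ p →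
        coarseHausdorffDist P (zonotope a) < dist r (zonotopeMap b e) := by
      refine hP.finite_polytopeVertices.eventually_all.2 fun r hr => ?_
      by_cases hrp : r = p
      · exact Eventually.of_forall fun _ h => (h hrp).elim
      refine (eventually_lt_dist_zonotopeMap ?_).mono fun _ h _ => h
      rw [← hdist, dist_comm, hnear.2, dist_comm]
      exact (Metric.infDist_le_dist_of_mem hr).lt_of_ne' fun h => hrp
        (huniq.unique ⟨hr, h⟩ hnear)
    filter_upwards [hev, ha.eventually_polytopeVertices_eq hn hd] with b hb hbV hle
    rw [coarseHausdorffDist_comm P (zonotope b)]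
    refine le_trans ?_ ((isPolytope_zonotope b).infDist_le_coarseHausdorffDist hP
      (p := zonotopeMap b e) (hbV ▸ Set.mem_image_of_mem _ heE))
    refine (Metric.le_infDist hP.polytopeVertices_nonempty).2 fun r hr => ?_
    rw [dist_comm]
    by_cases hrp : r = p
    · rw [hrp, ← hdist]
      exact dist_le_dist_zonotopeMap hle
    · exact (hb r hr hrp).le

end Coarse

/-! ### The Hausdorff distance -/

section Full

variable {n d : ℕ} {P : Set (EuclideanSpace ℝ (Fin d))} {a : ZonotopeParam n d}

/-- For a point stable relative to a zonotope at positive distance whose nearest point is a vertex,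
the difference is maximized over the zonotope exactly at this vertex. -/
theorem HausdorffStable.pos {p : EuclideanSpace ℝ (Fin d)} {e : Fin n → ℝ}
    (h : HausdorffStable (zonotope a) p) (hp : p ∉ interior (zonotope a))
    (he : e ∈ exposedCubeVertices a) (hnear : IsNearestPoint (zonotope a) p (zonotopeMap a e))
    (j : Fin n) : 0 < (2 * e j - 1) * inner ℝ (p - zonotopeMap a e) (a.1 j) := by
  obtain ⟨q, hq, hmem⟩ := h.resolve_left hp
  obtain rfl := hq.unique (convex_zonotope a) hnear
  exact pos_of_mem_intrinsicInterior_normalConeAt he hmem j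

theorem notMem_interior_zonotope_of_exposed (hn : 1 ≤ n) {e : Fin n → ℝ}
    (he : e ∈ exposedCubeVertices a) : zonotopeMap a e ∉ interior (zonotope a) := by
  obtain ⟨hc, u, hu⟩ := he
  intro hmem
  have hu0 : u ≠ 0 := by
    rintro rfl
    simpa using hu ⟨0, hn⟩
  have hcont : Continuous fun t : ℝ => zonotopeMap a e + t • u := by fun_prop
  have hev : ∀ᶠ t : ℝ in 𝓝 0, zonotopeMap a e + t • u ∈ interior (zonotope a) :=
    hcont.continuousAt.eventually (isOpen_interior.mem_nhds (by simpa using hmem))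
  obtain ⟨t, ht, ht0⟩ := ((hev.filter_mono nhdsWithin_le_nhds).and
    (self_mem_nhdsWithin : Set.Ioi (0 : ℝ) ∈ 𝓝[>] 0)).exists
  have h := inner_sub_zonotopeMap_nonneg hc (fun j => (hu j).le) (interior_subset ht)
  rw [sub_add_cancel_left, inner_neg_right, inner_smul_right] at h
  have := mul_pos (Set.mem_Ioi.1 ht0) (real_inner_self_pos.2 hu0)
  linarith

/-- If the two were equal, a vertex would be its own projection, and stability would put `0` among
the vectors exposing it. -/
theorem LocalityConditions.ne_zonotope (hn : 1 ≤ n) (hd : 1 ≤ d) (h : LocalityConditions P a) :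
    P ≠ zonotope a := by
  rintro rfl
  obtain ⟨q, hq⟩ := (isPolytope_zonotope a).polytopeVertices_nonempty
  have hstable := h.2.1 q hq
  obtain ⟨e, he, rfl⟩ :=
    exists_exposedCubeVertices_of_mem_polytopeVertices (h.1.ne_zero hd) hq
  have hmem := zonotopeMap_mem_zonotope a he.1
  have := hstable.pos (notMem_interior_zonotope_of_exposed hn he) he
    ⟨hmem, by rw [dist_self, Metric.infDist_zero_of_mem hmem]⟩ ⟨0, hn⟩
  simp at this

theorem IsPolytope.hausdorffDist_pos {Z : Set (EuclideanSpace ℝ (Fin d))}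
    (hP : IsPolytope P) (hZ : IsPolytope Z) (hne : P ≠ Z) : 0 < Metric.hausdorffDist P Z := by
  refine Metric.hausdorffDist_nonneg.lt_of_ne' fun h => hne ?_
  rwa [hP.isCompact.isClosed.hausdorffDist_zero_iff_eq hZ.isCompact.isClosed
    (hausdorffEDist_ne_top_of_isCompact hP.isCompact hZ.isCompact hP.nonempty hZ.nonempty)] at h

theorem interior_feasibilityCone_eq_empty (hn : 1 ≤ n) (hd : 1 ≤ d) (hP : IsPolytope P)
    (ha : GeneratorsInGeneralPosition a.1) (hne : P ≠ zonotope a)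
    (hmin : IsLocalMin (fun b => Metric.hausdorffDist P (zonotope b)) a) :
    interior (feasibilityCone P a) = ∅ := by
  refine Set.eq_empty_of_forall_notMem fun δ hδ => ?_
  have hZ := isPolytope_zonotope a
  have hD := hP.hausdorffDist_pos hZ hne
  set D := Metric.hausdorffDist P (zonotope a) with hDdef
  -- Here `e` ranges over the whole cube, since the projection of a vertex of `P` may fall inside a
  -- face of the zonotope.
  have hpos : ∀ p, ∀ e ∈ Set.Icc (0 : Fin n → ℝ) 1,
      ((p ∈ polytopeVertices P ∧ IsNearestPoint (zonotope a) p (zonotopeMap a e)) ∨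
        (zonotopeMap a e ∈ polytopeVertices (zonotope a) ∧
          IsNearestPoint P (zonotopeMap a e) p)) →
      dist p (zonotopeMap a e) = D →
      0 < inner ℝ (zonotopeMap δ e) (p - zonotopeMap a e) := by
    intro p e he hnear heq
    exact inner_pos_of_mem_interior_coneOfPairs (x := (p, zonotopeMap a e)) hδ
      ⟨heq, hnear⟩ (dist_pos.1 (heq ▸ hD)) ⟨he, rfl⟩
  have h1 : ∀ᶠ t : ℝ in 𝓝[>] 0, ∀ p ∈ polytopeVertices P, ∃ e ∈ Set.Icc (0 : Fin n → ℝ) 1,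
      dist p (zonotopeMap (a + t • δ) e) < D := by
    refine hP.finite_polytopeVertices.eventually_all.2 fun p hp => ?_
    obtain ⟨q, hq⟩ := hZ.isCompact.exists_isNearestPoint hZ.nonempty p
    obtain ⟨e, he, rfl⟩ := hq.1
    refine (eventually_dist_zonotopeMap_lt ?_ (hpos p e he (Or.inl ⟨hp, hq⟩))).mono
      fun t ht => ⟨e, he, ht⟩
    rw [hq.2]
    exact hP.infDist_le_hausdorffDist hZ hp.1
  have h2 : ∀ᶠ t : ℝ in 𝓝[>] 0, ∀ e ∈ exposedCubeVertices a, ∃ p ∈ P,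
      dist p (zonotopeMap (a + t • δ) e) < D := by
    refine (finite_exposedCubeVertices a).eventually_all.2 fun e he => ?_
    obtain ⟨p, hp⟩ := hP.isCompact.exists_isNearestPoint hP.nonempty (zonotopeMap a e)
    refine (eventually_dist_zonotopeMap_lt ?_ (hpos p e (cubeVertices_subset_Icc n he.1)
      (Or.inr ⟨zonotopeMap_mem_polytopeVertices he, hp⟩))).mono fun t ht => ⟨p, hp.1, ht⟩
    rw [dist_comm, hp.2, hDdef, Metric.hausdorffDist_comm]
    exact hZ.infDist_le_hausdorffDist hP (zonotopeMap_mem_zonotope a he.1)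
  obtain ⟨t, ht1, ht2, ht3, ht4⟩ := (h1.and (h2.and
    (((tendsto_add_smul_nhdsGT a δ).eventually (ha.eventually_polytopeVertices_eq hn hd)).and
      ((tendsto_add_smul_nhdsGT a δ).eventually hmin)))).exists
  refine ht4.not_gt (hP.hausdorffDist_lt (isPolytope_zonotope _) hD (fun p hp => ?_) ?_)
  · obtain ⟨e, he, h⟩ := ht1 p hp
    exact (Metric.infDist_le_dist_of_mem (Set.mem_image_of_mem _ he)).trans_lt h
  · rw [ht3]
    rintro _ ⟨e, he, rfl⟩
    obtain ⟨p, hp, h⟩ := ht2 e he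
    rw [dist_comm] at h
    exact (Metric.infDist_le_dist_of_mem hp).trans_lt h

theorem finite_achievingPairs {Z : Set (EuclideanSpace ℝ (Fin d))} (hP : IsPolytope P)
    (hZ : IsPolytope Z) : (achievingPairs P Z).Finite := by
  have h1 : (⋃ p ∈ polytopeVertices P,
      {x : EuclideanSpace ℝ (Fin d) × EuclideanSpace ℝ (Fin d) |
        x.1 = p ∧ IsNearestPoint Z p x.2}).Finite := by
    refine hP.finite_polytopeVertices.biUnion fun p _ => Set.Subsingleton.finite ?_
    rintro ⟨_, q⟩ ⟨rfl, hq⟩ ⟨_, r⟩ ⟨rfl, hr⟩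
    exact Prod.ext rfl (hq.unique hZ.convex hr)
  have h2 : (⋃ q ∈ polytopeVertices Z,
      {x : EuclideanSpace ℝ (Fin d) × EuclideanSpace ℝ (Fin d) |
        x.2 = q ∧ IsNearestPoint P q x.1}).Finite := by
    refine hZ.finite_polytopeVertices.biUnion fun p _ => Set.Subsingleton.finite ?_
    rintro ⟨q, _⟩ ⟨rfl, hq⟩ ⟨r, _⟩ ⟨rfl, hr⟩
    exact Prod.ext (hq.unique hP.convex hr) rfl
  refine (h1.union h2).subset ?_
  rintro x ⟨_, ⟨hx, hn⟩ | ⟨hx, hn⟩⟩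
  · exact Or.inl (Set.mem_biUnion hx ⟨rfl, hn⟩)
  · exact Or.inr (Set.mem_biUnion hx ⟨rfl, hn⟩)

theorem isLocalMin_hausdorffDist (hn : 1 ≤ n) (hd : 1 ≤ d) (hP : IsPolytope P)
    (ha : LocalityConditions P a)
    (hvert : ∀ x ∈ achievingPairs P (zonotope a), x.2 ∈ polytopeVertices (zonotope a))
    (hint : interior (feasibilityCone P a) = ∅) :
    IsLocalMin (fun b => Metric.hausdorffDist P (zonotope b)) a := by
  have ha0 := ha.1.ne_zero hd
  have hZ := isPolytope_zonotope a
  have hD := hP.hausdorffDist_pos hZ (ha.ne_zonotope hn hd)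
  refine isLocalMin_of_interior_coneOfPairs_eq_empty (finite_achievingPairs hP hZ)
    (fun x hx => finite_zonotopeLift ha0 (hvert x hx)) hint ?_
  rintro ⟨p, q⟩ hpq e he
  have hq := hvert _ hpq
  obtain ⟨hdist, hnear⟩ := hpq
  dsimp only at hdist hnear hq he ⊢
  have heE := mem_exposedCubeVertices_of_mem_zonotopeLift ha0 hq he
  obtain rfl := he.2
  rw [← hdist] at hD
  rcases hnear with ⟨hp, hnear⟩ | ⟨_, hnear⟩
  · have hpZ : p ∉ interior (zonotope a) := fun h => by
      rw [hnear.2, Metric.infDist_zero_of_mem (interior_subset h)] at hD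
      exact hD.false
    -- Stability makes the sign conditions for `p - q` strict, so they persist for `b` near `a`: the
    -- image of `e` still maximizes `p - q` over the new zonotope, which then lies in a half space
    -- at distance at least `‖p - q‖` from `p`.
    have hpos := (ha.2.1 p hp).pos hpZ heE hnear
    have hev : ∀ᶠ b : ZonotopeParam n d in 𝓝 a, ∀ j,
        0 < (2 * e j - 1) * inner ℝ (p - zonotopeMap a e) (b.1 j) := by
      refine eventually_all.2 fun j => ?_
      have hc : Continuous fun b : ZonotopeParam n d =>
          (2 * e j - 1) * inner ℝ (p - zonotopeMap a e) (b.1 j) := by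
        fun_prop
      exact hc.continuousAt.eventually (lt_mem_nhds (hpos j))
    filter_upwards [hev] with b hb hle
    refine le_trans ?_ (hP.infDist_le_hausdorffDist (isPolytope_zonotope b) hp.1)
    rw [← hdist, dist_eq_norm]
    refine norm_le_infDist_of_inner_le (zonotope_nonempty b) fun y hy => ?_
    have h := inner_sub_zonotopeMap_nonneg heE.1 (fun j => (hb j).le) hy
    have hsplit : p - y = (p - zonotopeMap a e) - (zonotopeMap b e - zonotopeMap a e)
        + (zonotopeMap b e - y) := by abel
    rw [hsplit, inner_add_right, inner_sub_right, real_inner_self_eq_norm_sq,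
      real_inner_comm (zonotopeMap b e - zonotopeMap a e)]
    linarith
  -- Since `P` is fixed, so is its supporting half space at `p` with normal `q - p`; the moved
  -- vertex stays at distance at least `‖q - p‖` from it.
  · refine Eventually.of_forall fun b hle => ?_
    rw [Metric.hausdorffDist_comm (t := zonotope b)]
    refine le_trans ?_ ((isPolytope_zonotope b).infDist_le_hausdorffDist hP
      (zonotopeMap_mem_zonotope b heE.1))
    rw [← hdist, dist_comm, dist_eq_norm]
    refine norm_le_infDist_of_inner_le hP.nonempty fun y hy => ?_
    have h := hnear.sub_mem_normalConeAt hP.convex y hy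
    have hsplit : zonotopeMap b e - y = (zonotopeMap b e - zonotopeMap a e)
        + (zonotopeMap a e - p) - (y - p) := by abel
    rw [hsplit, inner_sub_right, inner_add_right, real_inner_self_eq_norm_sq]
    rw [← neg_sub (zonotopeMap a e) p, inner_neg_right, real_inner_comm] at hle
    linarith

end Full

/-! ### The main theorem -/

theorem mainTheorem3 {n d : ℕ} (hn : 1 ≤ n) (hd : 1 ≤ d)
    (P : Set (EuclideanSpace ℝ (Fin d))) (hP : IsPolytope P) (a : ZonotopeParam n d) :
    (LocalityConditions P a →
      (∀ x ∈ achievingPairs P (zonotope a), x.2 ∈ polytopeVertices (zonotope a)) →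
        (interior (feasibilityCone P a) = ∅ ↔
          IsLocalMin (hausdorffTo P) (ZonotopeSpace.mk a))) ∧
    (GeneratorsInGeneralPosition a.1 → P ≠ zonotope a →
      (IsLocalMin (coarseHausdorffTo P) (ZonotopeSpace.mk a) →
        interior (coarseFeasibilityCone P a) = ∅) ∧
      (CoarseStable P (zonotope a) →
        (interior (coarseFeasibilityCone P a) = ∅ ↔
          IsLocalMin (coarseHausdorffTo P) (ZonotopeSpace.mk a)))) := by
  rw [ZonotopeSpace.isLocalMin_mk_iff, ZonotopeSpace.isLocalMin_mk_iff]
  refine ⟨fun ha hvert => ⟨isLocalMin_hausdorffDist hn hd hP ha hvert,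
    interior_feasibilityCone_eq_empty hn hd hP ha.1 (ha.ne_zonotope hn hd)⟩, fun ha hne => ?_⟩
  exact ⟨interior_coarseFeasibilityCone_eq_empty hn hd hP ha hne, fun hstable =>
    ⟨isLocalMin_coarseHausdorffDist hn hd hP ha hstable,
      interior_coarseFeasibilityCone_eq_empty hn hd hP ha hne⟩⟩
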